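/- Let $n\ge 1$. Let $\phi:\mathbb{R}^n\to[0,\infty)$ be convex, coercive ($\phi(z)\to\infty$ as $\|z\|_2\to\infty$) and even, let $\|\cdot\|$ be any norm on $\mathbb{R}^{n\times n}$, let $R\in(0,\infty]$ and $p\in(0,1]$. Consider the system $x_{t+1}=\bar A x_t+w_t+v_t$, $t=0,1,2,\dots$, with noise $w_t$ and attacks $v_t$, and write $\mathcal F_t=\sigma(x_0,\dots,x_t)$. Suppose that the $w_t$ are independent and identically distributed with a law on $\mathbb{R}^n$ that is bounded, symmetric ($w_t$ and $-w_t$ have the same law) and absolutely continuous with respect to Lebesgue measure; that $x_0$ is sub-Gaussian; that $\xi_t^{(i)}$ ($t\ge 0$, $1\le i\le n$) are independent $\mathrm{Bernoulli}(p)$ variables, $\xi_t^{(i)}=1$ meaning that node $i$ is open to attack at time $t$; and that $x_0$, $(w_t)_{t\ge0}$ and $(\xi_t^{(i)})_{t\ge 0,\,i\le n}$ are independent of one another. Then for the true system $\bar A=0$ there is a constant $\bar c>0$ such that the attack $$v_t=\bar c\,\frac{x_t}{\|x_t\|_2}\ \text{ if } t \text{ is odd and } \xi_t^{(i)}=1 \text{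 for all } i,\qquad v_t=0 \text{ otherwise},$$ (with $x_t/\|x_t\|_2:=0$ if $x_t=0$) has the following properties. 1. (Sub-Gaussian noise and attack.) Each $v_t$ is a function of $x_0,\dots,x_t$ and $\xi_t^{(1)},\dots,\xi_t^{(n)}$; there is $\sigma_v>0$ such that $\|x_0\|_{\psi_2}\le\sigma_v$ and, conditioned on $\mathcal F_t$, $\|v_t\|_{\psi_2}\le\sigma_v$ for all $t$; the $w_t$ have mean zero, are independent across time, satisfy $\|w_t\|_{\psi_2}\le\sigma_w$ for some $\sigma_w>0$, and $w_t$ is independent of $(x_0,\dots,x_t,v_0,\dots,v_t)$ for every $t$. Here $\|Y\|_{\psi_2}\le K$ means $\mathbb E\exp(\langle u,Y\rangle^2/K^2)\le 2$ for all unit vectors $u$. 2. (Node-wise probabilistic attack.) The $\xi_t^{(i)}$ are independent $\mathrm{Bernoulli}(p)$ variables, $(\xi_t^{(i)})_{i\le n}$ is independent of $\mathcal F_t$, and $\{\xi_t^{(i)}=0\}\subseteq\{v_t^{(i)}=0\}$ for all $t$ and $i$. 3. (Failure of the estimator.) If, for every $T\ge1$, $A_T$ almost surely minimizes $$\frac1T\sum_{t=0}^{T-1}\phi(x_{t+1}-Ax_t)\quad\text{subject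 to}\quad \|A\|\le R,$$ then, almost surely, $A_T$ does not converge to $\bar A=0$ as $T\to\infty$. -/

import Mathlib

open MeasureTheory ProbabilityTheory Filter Topology
open scoped ENNReal

/-- The state space `ℝⁿ` with the Euclidean norm. -/
abbrev State (n : ℕ) : Type := EuclideanSpace ℝ (Fin n)

namespace SysId

section Estimator

variable {n : ℕ}

/-- A standard loss `φ : ℝⁿ → ℝ₊`: convex, coercive and even. -/
structure IsStandardLoss (φ : State n → ℝ) : Prop where
  nonneg : ∀ z, 0 ≤ φ z
  convex : ConvexOn ℝ Set.univ φ
  coercive : Tendsto φ (Bornology.cobounded (State n)) atTop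
  even : ∀ z, φ (-z) = φ z

/-- The aggregate loss `(1/T) ∑_{t=0}^{T-1} φ(x_{t+1} - A x_t)` along the trajectory `x`. -/
noncomputable def empiricalLoss (φ : State n → ℝ) (x : ℕ → State n) (T : ℕ)
    (A : Matrix (Fin n) (Fin n) ℝ) : ℝ :=
  (1 / (T : ℝ)) * ∑ t ∈ Finset.range T, φ (x (t + 1) - A.toEuclideanLin (x t))

/-- The constraint set `{A : ‖A‖ ≤ R}` of the matrix norm `N`; `R = ∞` means no constraint. -/
def feasibleSet (N : Seminorm ℝ (Matrix (Fin n) (Fin n) ℝ)) (R : ℝ≥0∞) :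
    Set (Matrix (Fin n) (Fin n) ℝ) :=
  {A | ENNReal.ofReal (N A) ≤ R}

/-- `A` minimizes the aggregate loss over the trajectory `x₀, …, x_T` subject to `‖A‖ ≤ R`. -/
def IsEstimate (φ : State n → ℝ) (N : Seminorm ℝ (Matrix (Fin n) (Fin n) ℝ)) (R : ℝ≥0∞)
    (x : ℕ → State n) (T : ℕ) (A : Matrix (Fin n) (Fin n) ℝ) : Prop :=
  A ∈ feasibleSet N R ∧ IsMinOn (empiricalLoss φ x T) (feasibleSet N R) A

end Estimator

section Noise

variable {n : ℕ}

/-- A bounded, symmetric and absolutely continuous probability law on `ℝⁿ`. -/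
structure IsBddSymmAC (ν : Measure (State n)) : Prop where
  prob : IsProbabilityMeasure ν
  bounded : ∃ B : ℝ, ∀ᵐ z ∂ν, ‖z‖ ≤ B
  symm : ν.map (fun z => -z) = ν
  absCont : ν ≪ volume

end Noise

section System

variable {n : ℕ} {Ω : Type*} [mΩ : MeasurableSpace Ω]

/-- `‖Y‖_{ψ₂} ≤ K`: for every unit vector `u`, `𝔼[exp(⟪u, Y⟫² / K²)] ≤ 2`. -/
def PsiTwoLE (P : Measure Ω) (Y : Ω → State n) (K : ℝ) : Prop :=
  0 < K ∧ AEMeasurable Y P ∧ ∀ u : State n, ‖u‖ = 1 →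
    ∫⁻ ω, ENNReal.ofReal (Real.exp ((inner ℝ u (Y ω)) ^ 2 / K ^ 2)) ∂P ≤ 2

/-- `‖Y‖_{ψ₂} ≤ K` conditioned on the sub-σ-algebra `m`: for every unit vector `u`,
`𝔼[exp(⟪u, Y⟫² / K²) | m] ≤ 2` almost surely. -/
def CondPsiTwoLE (P : Measure Ω) (m : MeasurableSpace Ω) (Y : Ω → State n) (K : ℝ) : Prop :=
  0 < K ∧ AEMeasurable Y P ∧ m ≤ mΩ ∧ ∀ u : State n, ‖u‖ = 1 →
    ∀ᵐ ω ∂P,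
      condLExp m P (fun ω' => ENNReal.ofReal (Real.exp ((inner ℝ u (Y ω')) ^ 2 / K ^ 2))) ω ≤ 2

/-- The history `𝓕_t = σ(x₀, …, x_t)`. -/
abbrev history (x : ℕ → Ω → State n) (t : ℕ) : MeasurableSpace Ω :=
  ⨆ s ∈ Set.Iic t, MeasurableSpace.comap (x s) inferInstance

/-- The σ-algebra generated by the attack indicators `(ξ_t^{(1)}, …, ξ_t^{(n)})` at time `t`. -/
abbrev attackTimes (ξ : ℕ → Fin n → Ω → Bool) (t : ℕ) : MeasurableSpace Ω :=
  MeasurableSpace.comap (fun ω i => ξ t i ω) inferInstance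

/-- The linear dynamics `x_{t+1} = Ā x_t + w_t + v_t`, started at `x₀`. -/
structure IsTrajectory (Abar : Matrix (Fin n) (Fin n) ℝ) (x₀ : Ω → State n)
    (w v x : ℕ → Ω → State n) : Prop where
  init : ∀ ω, x 0 ω = x₀ ω
  step : ∀ t ω, x (t + 1) ω = Abar.toEuclideanLin (x t ω) + w t ω + v t ω

/-- Sub-Gaussian noise and attack. The attack `v_t` is chosen from the history `𝓕_t` (and the
knowledge of which nodes are open to attack at time `t`) and is sub-Gaussian conditioned on `𝓕_t`;
the noise is centred, sub-Gaussian, independent across time, and `w_t` is independent of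
the initial state and of the attacks and states up to time `t`. -/
structure SubGaussianNoiseAttack (P : Measure Ω) (ξ : ℕ → Fin n → Ω → Bool)
    (w v x : ℕ → Ω → State n) : Prop where
  attack_adapted : ∀ t, Measurable[history x t ⊔ attackTimes ξ t] (v t)
  attack_subGaussian : ∃ σv : ℝ, (∀ t, CondPsiTwoLE P (history x t) (v t) σv) ∧ PsiTwoLE P (x 0) σv
  noise_zero_mean : ∀ t, Integrable (w t) P ∧ ∫ ω, w t ω ∂P = 0
  noise_indep : iIndepFun w P
  noise_indep_attack : ∀ t,
    Indep (MeasurableSpace.comap (w t) inferInstance) (history x t ⊔ history v t) P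
  noise_subGaussian : ∃ σw : ℝ, ∀ t, PsiTwoLE P (w t) σw

/-- Node-wise probabilistic attack: the indicators `ξ_t^{(i)}` are independent `Bernoulli(p)`
variables, those at time `t` are independent of `𝓕_t`, and `ξ_t^{(i)} = 0` forces
`v_t^{(i)} = 0`. -/
structure NodewiseAttack (P : Measure Ω) (p : ℝ) (ξ : ℕ → Fin n → Ω → Bool)
    (v x : ℕ → Ω → State n) : Prop where
  measurable : ∀ t i, Measurable (ξ t i)
  bernoulli : ∀ t i, P {ω | ξ t i ω = true} = ENNReal.ofReal p
  indep : iIndepFun (fun k : ℕ × Fin n => ξ k.1 k.2) P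
  indep_history : ∀ t, Indep (attackTimes ξ t) (history x t) P
  masked : ∀ t i ω, ξ t i ω = false → v t ω i = 0

open Classical in
/-- The attack that injects `c x_t / ‖x_t‖` at those odd times at which every node is open to
attack, and nothing at any other time. -/
noncomputable def oddAttack (c : ℝ) (ξ : ℕ → Fin n → Ω → Bool) (x : ℕ → Ω → State n)
    (t : ℕ) (ω : Ω) : State n :=
  if Odd t ∧ ∀ i, ξ t i ω = true then (c / ‖x t ω‖) • x t ω else 0

end System

end SysId

/-! The estimator fails because a small matrix `a • 1` with `a > 0` beats `0` by a margin that
survives averaging. No attack occurs at even times and `Ā = 0`, so the state at an odd time `t` is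
exactly the noise `w (t - 1)`. If the attack then fires, the next state is `w t + c x_t / ‖x_t‖`,
and subtracting `a • x_t` moves it straight back towards `w t`. The size `c` is chosen so that `φ`
at the attacked point exceeds its maximum over the noise ball by at least one; convexity then yields
a gain of at least `a ‖x_t‖ / c`, which is of first order in `a` (`convexOn_sub_smul_le`).

At an unattacked step the next state is noise independent of `x_t`. Evenness of `φ` and symmetry of
the noise turn the expected change of loss into half a symmetric second difference. This is `o(a)`
because a convex function is differentiable almost everywhere and the noise law is absolutely
continuous (`tendsto_integral_shift`). Hence the expected gain over an odd step and the following
even step is positive for small `a` (`integrable_and_eventually_integral_blockGain_pos`).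

Each such pair of steps depends only on three consecutive noises and one vector of indicators, so
the strong law turns the expected gain into an almost sure one (`ae_tendsto_average_even_window`).
If the minimizers tended to `0`, their average loss would approach that of `0`, since `φ` is
Lipschitz on balls and the trajectory is bounded; this contradicts minimality against `a • 1`
(`not_tendsto_zero_of_gain`). -/

namespace SysId

/-! ### Convex functions: second differences and random shifts -/

section Convex

variable {E : Type*} [NormedAddCommGroup E] [NormedSpace ℝ E]

/-- The symmetric second difference of a function at a point of differentiability is `o(a)`. -/
lemma tendsto_second_difference {f : E → ℝ} {z : E} (hf : DifferentiableAt ℝ f z) (x : E) :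
    Tendsto (fun a : ℝ => a⁻¹ * (f (z + a • x) + f (z - a • x) - 2 * f z)) (𝓝[>] 0) (𝓝 0) := by
  have h1 := hasDerivAt_iff_tendsto_slope_zero.1 (hf.hasFDerivAt.hasLineDerivAt x)
  have h2 := hasDerivAt_iff_tendsto_slope_zero.1 (hf.hasFDerivAt.hasLineDerivAt (-x))
  have h := (h1.add h2).mono_left (nhdsGT_le_nhdsNE (0 : ℝ))
  rw [map_neg, add_neg_cancel] at h
  refine h.congr fun a => ?_
  simp only [zero_add, zero_smul, add_zero, neg_zero, smul_eq_mul, smul_neg, ← sub_eq_add_neg]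
  ring

/-- Moving from `y + (c / ‖x‖) • x` towards `y` decreases a convex function at rate at least `1 / c`
when the values at the two endpoints are separated by one. -/
lemma convexOn_sub_smul_le {f : E → ℝ} (hf : ConvexOn ℝ Set.univ f) {x y : E} {M a c : ℝ}
    (hx : x ≠ 0) (hc : 0 < c) (ha : 0 ≤ a) (hac : a * ‖x‖ ≤ c) (hy : f y ≤ M)
    (hyx : M + 1 ≤ f (y + (c / ‖x‖) • x)) :
    f (y + (c / ‖x‖) • x - a • x) ≤ f (y + (c / ‖x‖) • x) - a * ‖x‖ / c := by
  have hx' : 0 < ‖x‖ := norm_pos_iff.2 hx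
  -- The segment back to `y` has length `c`; `s` is the fraction of it covered by the shift `a • x`.
  set s := a * ‖x‖ / c with hs
  have hs0 : 0 ≤ s := by positivity
  have hs1 : s ≤ 1 := (div_le_one hc).2 hac
  have h := hf.2 (Set.mem_univ (y + (c / ‖x‖) • x)) (Set.mem_univ y)
    (sub_nonneg.2 hs1) hs0 (by ring)
  have e : (1 - s) • (y + (c / ‖x‖) • x) + s • y = y + (c / ‖x‖) • x - a • x := by
    have : s * (c / ‖x‖) = a := by rw [hs]; field_simp
    rw [← this]
    module
  rw [e] at h
  simp only [smul_eq_mul] at h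
  nlinarith

variable [FiniteDimensional ℝ E]

/-- A convex function on a finite-dimensional space is Lipschitz on every closed ball. -/
lemma exists_lipschitzOnWith_closedBall {f : E → ℝ} (hf : ConvexOn ℝ Set.univ f) (r : ℝ) :
    ∃ K, LipschitzOnWith K f (Metric.closedBall 0 r) := by
  have : ProperSpace E := FiniteDimensional.proper ℝ E
  exact (hf.locallyLipschitz.locallyLipschitzOn).exists_lipschitzOnWith_of_compact
    (isCompact_closedBall 0 r)

/-- A convex function on a finite-dimensional space is differentiable almost everywhere. -/
lemma ae_differentiableAt_of_convexOn [MeasurableSpace E] [BorelSpace E] {μ : Measure E}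
    [μ.IsAddHaarMeasure] {f : E → ℝ} (hf : ConvexOn ℝ Set.univ f) :
    ∀ᵐ z ∂μ, DifferentiableAt ℝ f z := by
  -- Rademacher's theorem applies on each integer ball, where `f` is Lipschitz; the balls exhaust
  -- the space.
  have h : ∀ k : ℕ, ∀ᵐ z ∂μ, z ∈ Metric.closedBall (0 : E) k →
      DifferentiableWithinAt ℝ f (Metric.closedBall 0 k) z := fun k => by
    obtain ⟨K, hK⟩ := exists_lipschitzOnWith_closedBall hf (k : ℝ)
    exact hK.ae_differentiableWithinAt_of_mem
  filter_upwards [ae_all_iff.2 h] with z hz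
  obtain ⟨k, hk⟩ := exists_nat_gt ‖z‖
  have hzk : z ∈ Metric.ball (0 : E) k := by simpa using hk
  exact (hz k (Metric.ball_subset_closedBall hzk)).differentiableAt
    (mem_of_superset (Metric.isOpen_ball.mem_nhds hzk) Metric.ball_subset_closedBall)

/-- If `W` has a symmetric absolutely continuous law and is independent of the bounded variable
`X`, then shifting `W` by `a • X` changes the mean of an even convex function by `o(a)` only. -/
lemma tendsto_integral_shift {Ω : Type*} [MeasurableSpace Ω] {P : Measure Ω}
    [IsProbabilityMeasure P] [MeasurableSpace E] [BorelSpace E] {μ : Measure E}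
    [μ.IsAddHaarMeasure] {f : E → ℝ} (hf : ConvexOn ℝ Set.univ f) (heven : ∀ z, f (-z) = f z)
    {W X : Ω → E} (hW : Measurable W) (hX : Measurable X) (hWX : IndepFun W X P) {B : ℝ}
    (hWB : ∀ᵐ ω ∂P, ‖W ω‖ ≤ B) (hXB : ∀ᵐ ω ∂P, ‖X ω‖ ≤ B)
    (hsymm : (P.map W).map (fun z => -z) = P.map W) (hac : P.map W ≪ μ) :
    Tendsto (fun a : ℝ => a⁻¹ * ∫ ω, (f (W ω - a • X ω) - f (W ω)) ∂P) (𝓝[>] 0) (𝓝 0) := by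
  have hfc : Continuous f := hf.locallyLipschitz.continuous
  have hfm : Measurable f := hfc.measurable
  -- Radius `2 * B` accommodates `W + b • X` for all `|b| ≤ 1`.
  obtain ⟨K, hK⟩ := exists_lipschitzOnWith_closedBall hf (2 * B)
  have hB : 0 ≤ B := by
    obtain ⟨ω, hω⟩ := hWB.exists
    exact (norm_nonneg _).trans hω
  have hlip : ∀ b : ℝ, |b| ≤ 1 → ∀ᵐ ω ∂P, |f (W ω + b • X ω) - f (W ω)| ≤ K * (|b| * B) := by
    intro b hb
    filter_upwards [hWB, hXB] with ω h1 h2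
    have hbX : ‖b • X ω‖ ≤ |b| * B := by
      rw [norm_smul, Real.norm_eq_abs]
      gcongr
    have h3 : ‖W ω + b • X ω‖ ≤ 2 * B := by
      have : |b| * B ≤ 1 * B := by gcongr
      linarith [norm_add_le (W ω) (b • X ω)]
    have := hK.dist_le_mul _ (by simpa using h3) (W ω) (by simpa using h1.trans (by linarith))
    rw [Real.dist_eq, dist_eq_norm, add_sub_cancel_left] at this
    exact this.trans (by gcongr)
  have hint : ∀ b : ℝ, |b| ≤ 1 → Integrable (fun ω => f (W ω + b • X ω) - f (W ω)) P := by
    intro b hb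
    refine Integrable.of_bound ?_ (K * (|b| * B)) (by simpa [Real.norm_eq_abs] using hlip b hb)
    exact (Measurable.sub (hfm.comp (hW.add (hX.const_smul b))) (hfm.comp hW)).aestronglyMeasurable
  have hident : IdentDistrib (fun ω => (-W ω, X ω)) (fun ω => (W ω, X ω)) P P := by
    have hn : IdentDistrib (fun ω => -W ω) W P P :=
      ⟨hW.neg.aemeasurable, hW.aemeasurable, by
        rw [← hsymm, Measure.map_map measurable_neg hW]
        rfl⟩
    exact hn.prodMk (IdentDistrib.refl hX.aemeasurable) hWX.neg_left hWX
  -- Replacing `W` by `-W` preserves the joint law with `X`, and evenness of `f` then reverses the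
  -- shift. Each one-sided mean is therefore half the mean symmetric second difference.
  have hsym : ∀ a : ℝ, ∫ ω, (f (W ω + a • X ω) - f (W ω)) ∂P
      = ∫ ω, (f (W ω - a • X ω) - f (W ω)) ∂P := by
    intro a
    have hg : Measurable fun q : E × E => f (q.1 - a • q.2) - f q.1 := by
      have : Continuous fun q : E × E => f (q.1 - a • q.2) - f q.1 := by fun_prop
      exact this.measurable
    have := (hident.comp hg).integral_eq
    simp only [Function.comp_def] at this
    rw [← this]
    refine integral_congr_ae (.of_forall fun ω => ?_)
    simp only
    rw [heven, ← heven (-W ω - a • X ω)]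
    congr 2
    abel
  have hmain : Tendsto (fun a : ℝ => ∫ ω, a⁻¹ * (f (W ω + a • X ω) + f (W ω - a • X ω)
      - 2 * f (W ω)) ∂P) (𝓝[>] 0) (𝓝 (∫ _, (0 : ℝ) ∂P)) := by
    have hsmall : ∀ᶠ a : ℝ in 𝓝[>] 0, 0 < a ∧ a ≤ 1 := by
      filter_upwards [Ioc_mem_nhdsGT (zero_lt_one' ℝ)] with a ha using ha
    refine tendsto_integral_filter_of_dominated_convergence (fun _ => 2 * (K * B)) ?_ ?_
      (integrable_const _) ?_
    · refine .of_forall fun a => Measurable.aestronglyMeasurable ?_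
      exact ((((hfm.comp (hW.add (hX.const_smul a))).add
        (hfm.comp (hW.sub (hX.const_smul a)))).sub ((hfm.comp hW).const_mul 2)).const_mul a⁻¹)
    · filter_upwards [hsmall] with a ha
      have ha' : |a| ≤ 1 := by rw [abs_of_pos ha.1]; exact ha.2
      filter_upwards [hlip a ha', hlip (-a) (by rwa [abs_neg])] with ω h1 h2
      rw [abs_neg, neg_smul, ← sub_eq_add_neg] at h2
      rw [abs_of_pos ha.1] at h1 h2
      rw [norm_mul, norm_inv, Real.norm_eq_abs, Real.norm_eq_abs, abs_of_pos ha.1,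
        inv_mul_le_iff₀ ha.1]
      calc _ = |(f (W ω + a • X ω) - f (W ω)) + (f (W ω - a • X ω) - f (W ω))| := by
            congr 1; ring
        _ ≤ _ := (abs_add_le _ _).trans (by linarith)
    · have : ∀ᵐ ω ∂P, DifferentiableAt ℝ f (W ω) :=
        ae_of_ae_map hW.aemeasurable (hac.ae_le (ae_differentiableAt_of_convexOn hf))
      filter_upwards [this] with ω hω using tendsto_second_difference hω _
  rw [integral_zero] at hmain
  have h2 := hmain.const_mul (1 / 2)
  rw [mul_zero] at h2
  refine h2.congr' ?_
  filter_upwards [Ioc_mem_nhdsGT (zero_lt_one' ℝ)] with a ha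
  have ha' : |a| ≤ 1 := by rw [abs_of_pos ha.1]; exact ha.2
  have e : ∀ ω, f (W ω + a • X ω) + f (W ω - a • X ω) - 2 * f (W ω)
      = (f (W ω + a • X ω) - f (W ω)) + (f (W ω - a • X ω) - f (W ω)) := fun ω => by ring
  have hi := hint (-a) (by rwa [abs_neg])
  simp only [neg_smul, ← sub_eq_add_neg] at hi
  simp only [e]
  rw [integral_const_mul, integral_add (hint a ha') hi, hsym]
  ring

end Convex

/-! ### Independence and the strong law for windows -/

section Independence

variable {Ω : Type*} [MeasurableSpace Ω] {P : Measure Ω} [IsProbabilityMeasure P]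
  {α β γ δ : Type*} [MeasurableSpace α] [MeasurableSpace β] [MeasurableSpace γ] [MeasurableSpace δ]

lemma indepFun_prodMk_right {X : Ω → α} {Y : Ω → β} {Z : Ω → γ} (hX : Measurable X)
    (hY : Measurable Y) (hZ : Measurable Z) (hXY : IndepFun X Y P)
    (hXYZ : IndepFun (fun ω => (X ω, Y ω)) Z P) : IndepFun X (fun ω => (Y ω, Z ω)) P := by
  have hYZ : IndepFun Y Z P := hXYZ.comp measurable_snd measurable_id
  have : IsProbabilityMeasure (P.map X) := Measure.isProbabilityMeasure_map hX.aemeasurable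
  have : IsProbabilityMeasure (P.map Y) := Measure.isProbabilityMeasure_map hY.aemeasurable
  have : IsProbabilityMeasure (P.map Z) := Measure.isProbabilityMeasure_map hZ.aemeasurable
  rw [indepFun_iff_map_prod_eq_prod_map_map hX.aemeasurable (hY.prodMk hZ).aemeasurable,
    hYZ.map_prod_eq_prod_map_map hY.aemeasurable hZ.aemeasurable, ← Measure.prodAssoc_prod,
    ← hXY.map_prod_eq_prod_map_map hX.aemeasurable hY.aemeasurable,
    ← hXYZ.map_prod_eq_prod_map_map (hX.prodMk hY).aemeasurable hZ.aemeasurable,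
    Measure.map_map MeasurableEquiv.prodAssoc.measurable ((hX.prodMk hY).prodMk hZ)]
  rfl

/-- Regroups four variables from rows to columns: noises and indicators are independent of one
another and across windows, and the resulting windows must be independent as pairs. -/
lemma indepFun_prodMk_prodMk {X : Ω → α} {X' : Ω → β} {Y : Ω → γ} {Y' : Ω → δ}
    (hX : Measurable X) (hX' : Measurable X') (hY : Measurable Y) (hY' : Measurable Y')
    (hXX' : IndepFun X X' P) (hYY' : IndepFun Y Y' P)
    (h : IndepFun (fun ω => (X ω, X' ω)) (fun ω => (Y ω, Y' ω)) P) :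
    IndepFun (fun ω => (X ω, Y ω)) (fun ω => (X' ω, Y' ω)) P := by
  have h1 : IndepFun X' (fun ω => (X ω, Y ω)) P :=
    indepFun_prodMk_right hX' hX hY hXX'.symm (h.comp measurable_swap measurable_fst)
  have h2 : IndepFun Y' (fun ω => (Y ω, (X ω, X' ω))) P :=
    indepFun_prodMk_right hY' hY (hX.prodMk hX') hYY'.symm (h.symm.comp measurable_swap measurable_id)
  refine indepFun_prodMk_right (hX.prodMk hY) hX' hY' h1.symm ?_
  have hm : Measurable fun q : γ × (α × β) => ((q.2.1, q.1), q.2.2) := by fun_prop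
  exact (h2.comp measurable_id hm).symm

/-- The strong law of large numbers for a bounded function of the disjoint windows
`(w (4j + s), …, w (4j + s + 2), ξ (4j + s + 1))`, with mean evaluated at the first window. -/
lemma ae_tendsto_average_window {w : ℕ → Ω → α} {ξ : ℕ → Ω → β} (hw : ∀ t, Measurable (w t))
    (hξ : ∀ t, Measurable (ξ t)) (hwi : iIndepFun w P) (hξi : Pairwise fun s t => IndepFun (ξ s) (ξ t) P)
    (hwd : ∀ t, IdentDistrib (w t) (w 0) P P) (hξd : ∀ t, IdentDistrib (ξ t) (ξ 1) P P)
    (hwξ : IndepFun (fun ω t => w t ω) (fun ω t => ξ t ω) P)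
    {F : (Fin 3 → α) × β → ℝ} (hF : Measurable F)
    (hint : Integrable (fun ω => F (fun i => w i ω, ξ 1 ω)) P) (s : ℕ) :
    ∀ᵐ ω ∂P, Tendsto (fun m : ℕ =>
      (∑ j ∈ Finset.range m, F (fun i => w (4 * j + s + i) ω, ξ (4 * j + s + 1) ω)) / m) atTop
      (𝓝 (∫ ω, F (fun i => w i ω, ξ 1 ω) ∂P)) := by
  have hwin : ∀ k, Measurable fun ω => fun i : Fin 3 => w (k + i) ω :=
    fun k => measurable_pi_lambda _ fun i => hw _
  have hev : ∀ k, Measurable fun f : ℕ → β => f k := measurable_pi_apply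
  have hid : ∀ k, IdentDistrib (fun ω => ((fun i : Fin 3 => w (k + i) ω), ξ (k + 1) ω))
      (fun ω => ((fun i : Fin 3 => w i ω), ξ 1 ω)) P P := by
    intro k
    refine IdentDistrib.prodMk ?_ (hξd _) ?_ ?_
    · refine IdentDistrib.pi (fun i => (hwd _).trans (hwd _).symm) ?_ ?_
      · exact hwi.precomp (g := fun i : Fin 3 => k + (i : ℕ)) fun i j h => by
          simpa [Fin.ext_iff] using h
      · exact hwi.precomp (g := fun i : Fin 3 => (i : ℕ)) fun i j h => by
          simpa [Fin.ext_iff] using h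
    · exact hwξ.comp (φ := fun f (i : Fin 3) => f (k + i)) (ψ := fun f => f (k + 1))
        (by fun_prop) (hev _)
    · exact hwξ.comp (φ := fun f (i : Fin 3) => f i) (ψ := fun f => f 1)
        (by fun_prop) (hev _)
  have hX := fun j => (hid (4 * j + s)).comp hF
  have hX0 : ∀ j, IdentDistrib
      (fun ω => F (fun i => w (4 * j + s + i) ω, ξ (4 * j + s + 1) ω))
      (fun ω => F (fun i => w (4 * 0 + s + i) ω, ξ (4 * 0 + s + 1) ω)) P P :=
    fun j => (hX j).trans (hX 0).symm
  have hpair : Pairwise fun k l => IndepFun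
      (fun ω => F (fun i => w (4 * k + s + i) ω, ξ (4 * k + s + 1) ω))
      (fun ω => F (fun i => w (4 * l + s + i) ω, ξ (4 * l + s + 1) ω)) P := by
    intro k l hkl
    refine IndepFun.comp (f := fun ω => ((fun i : Fin 3 => w (4 * k + s + i) ω), ξ (4 * k + s + 1) ω))
      (g := fun ω => ((fun i : Fin 3 => w (4 * l + s + i) ω), ξ (4 * l + s + 1) ω)) ?_ hF hF
    refine indepFun_prodMk_prodMk (hwin _) (hwin _) (hξ _) (hξ _) ?_ (hξi (by omega)) ?_
    -- The stride 4 exceeds the window length 3, so windows with the same offset `s` share no noise.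
    · have hd : Disjoint (Finset.Ico (4 * k + s) (4 * k + s + 3))
          (Finset.Ico (4 * l + s) (4 * l + s + 3)) := by
        rw [Finset.disjoint_left]
        intro a ha hb
        rw [Finset.mem_Ico] at ha hb
        omega
      have := hwi.indepFun_finset _ _ hd hw
      have hmem : ∀ (q : ℕ) (i : Fin 3), q + (i : ℕ) ∈ Finset.Ico q (q + 3) := fun q i => by
        rw [Finset.mem_Ico]; omega
      exact this.comp
        (φ := fun f (i : Fin 3) => f ⟨4 * k + s + i, hmem _ i⟩)
        (ψ := fun f (i : Fin 3) => f ⟨4 * l + s + i, hmem _ i⟩) (by fun_prop) (by fun_prop)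
    · exact hwξ.comp
        (φ := fun f => ((fun i : Fin 3 => f (4 * k + s + i)), fun i : Fin 3 => f (4 * l + s + i)))
        (ψ := fun f => (f (4 * k + s + 1), f (4 * l + s + 1))) (by fun_prop) (by fun_prop)
  have := strong_law_ae_real _ ((hX 0).integrable_iff.2 hint) hpair hX0
  have he := (hX 0).integral_eq
  simp only [Function.comp_def] at he
  rwa [he] at this

/-- The strong law of large numbers for the overlapping windows of length three that start at even
times. -/
lemma ae_tendsto_average_even_window {w : ℕ → Ω → α} {ξ : ℕ → Ω → β} (hw : ∀ t, Measurable (w t))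
    (hξ : ∀ t, Measurable (ξ t)) (hwi : iIndepFun w P) (hξi : Pairwise fun s t => IndepFun (ξ s) (ξ t) P)
    (hwd : ∀ t, IdentDistrib (w t) (w 0) P P) (hξd : ∀ t, IdentDistrib (ξ t) (ξ 1) P P)
    (hwξ : IndepFun (fun ω t => w t ω) (fun ω t => ξ t ω) P)
    {F : (Fin 3 → α) × β → ℝ} (hF : Measurable F)
    (hint : Integrable (fun ω => F (fun i => w i ω, ξ 1 ω)) P) :
    ∀ᵐ ω ∂P, Tendsto (fun m : ℕ =>
      (∑ k ∈ Finset.range (2 * m), F (fun i => w (2 * k + i) ω, ξ (2 * k + 1) ω)) / m) atTop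
      (𝓝 (2 * ∫ ω, F (fun i => w i ω, ξ 1 ω) ∂P)) := by
  -- Windows starting at consecutive even times share one noise. Offsets 0 and 2 modulo 4 split them
  -- into two families of disjoint windows.
  filter_upwards [ae_tendsto_average_window hw hξ hwi hξi hwd hξd hwξ hF hint 0,
    ae_tendsto_average_window hw hξ hwi hξi hwd hξd hwξ hF hint 2] with ω h0 h2
  have h := h0.add h2
  rw [← two_mul] at h
  refine h.congr fun m => ?_
  rw [← add_div]
  congr 1
  induction m with
  | zero => simp
  | succ m ih =>
    rw [Finset.sum_range_succ, Finset.sum_range_succ, mul_add, mul_one, Finset.sum_range_succ,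
      Finset.sum_range_succ, ← ih, show 2 * (2 * m) = 4 * m + 0 by ring,
      show 2 * (2 * m + 1) = 4 * m + 2 by ring]
    ring

end Independence

/-! ### Minimizers along a fixed bounded trajectory -/

section Consistency

variable {n : ℕ}

lemma toEuclideanLin_smul_one (a : ℝ) (z : State n) :
    (a • (1 : Matrix (Fin n) (Fin n) ℝ)).toEuclideanLin z = a • z := by
  ext i
  simp [Matrix.toEuclideanLin]

lemma tendsto_norm_toEuclideanCLM {A : ℕ → Matrix (Fin n) (Fin n) ℝ}
    (hA : Tendsto A atTop (𝓝 0)) :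
    Tendsto (fun T => ‖Matrix.toEuclideanCLM (n := Fin n) (𝕜 := ℝ) (A T)‖) atTop (𝓝 0) := by
  let f : Matrix (Fin n) (Fin n) ℝ →ₗ[ℝ] (State n →L[ℝ] State n) :=
    (Matrix.toEuclideanCLM (n := Fin n) (𝕜 := ℝ)).toAlgEquiv.toLinearMap
  have hf : Continuous f := f.continuous_of_finiteDimensional
  have := (hf.tendsto 0).comp hA
  rw [map_zero] at this
  have h := this.norm
  rw [norm_zero] at h
  exact h

/-- A sequence of minimizers along a bounded trajectory cannot converge to `0` if some feasible
`a • 1` has a loss that is lower than that of `0` by a margin that does not vanish. -/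
lemma not_tendsto_zero_of_gain {φ : State n → ℝ} (hφ : ConvexOn ℝ Set.univ φ)
    {N : Seminorm ℝ (Matrix (Fin n) (Fin n) ℝ)} {R : ℝ≥0∞} {x : ℕ → State n} {M : ℝ}
    (hx : ∀ t, ‖x t‖ ≤ M) {A : ℕ → Matrix (Fin n) (Fin n) ℝ}
    (hA : ∀ T, 1 ≤ T → IsEstimate φ N R x T (A T)) {a : ℝ}
    (ha : a • (1 : Matrix (Fin n) (Fin n) ℝ) ∈ feasibleSet N R) {δ : ℝ} (hδ : 0 < δ)
    (hgain : Tendsto (fun m : ℕ => (∑ t ∈ Finset.range (4 * m + 1),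
      (φ (x (t + 1)) - φ (x (t + 1) - a • x t))) / m) atTop (𝓝 δ)) :
    ¬ Tendsto A atTop (𝓝 0) := by
  intro hlim
  obtain ⟨K, hK⟩ := exists_lipschitzOnWith_closedBall hφ (2 * M)
  have hM : 0 ≤ M := (norm_nonneg _).trans (hx 0)
  have hnorm := tendsto_norm_toEuclideanCLM hlim
  -- The bound 1 keeps residuals in the ball of radius `2 * M`; the other bound limits the
  -- improvement per step to `δ / 16`. Over `T ≤ 5 * m` steps this totals at most `5 * m * δ / 16`,
  -- below the gain `m * δ / 2` of `a • 1`.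
  have hsmall : ∀ᶠ T in atTop,
      ‖Matrix.toEuclideanCLM (n := Fin n) (𝕜 := ℝ) (A T)‖ < min 1 (δ / (16 * (K * M + 1))) :=
    hnorm.eventually_lt_const (by positivity)
  have hsub : Tendsto (fun m : ℕ => 4 * m + 1) atTop atTop :=
    tendsto_atTop_mono (fun m => by simp only [id_eq]; omega) tendsto_id
  have hbig := hgain.eventually_const_lt (show δ / 2 < δ by linarith)
  obtain ⟨m, hm1, hm2, hm3⟩ := ((eventually_ge_atTop 1).and (hbig.and (hsub.eventually hsmall))).exists
  set T := 4 * m + 1 with hT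
  have hmpos : (0 : ℝ) < m := by exact_mod_cast hm1
  have hTpos : (0 : ℝ) < T := by positivity
  have hT5 : (T : ℝ) ≤ 5 * m := by
    have : (1 : ℝ) ≤ m := by exact_mod_cast hm1
    rw [hT]; push_cast; linarith
  have hmin := (hA T (by omega)).2 ha
  simp only [Set.mem_ofPred_eq, empiricalLoss] at hmin
  have hmin' := le_of_mul_le_mul_left hmin (by positivity)
  have hterm : ∀ t, φ (x (t + 1)) - δ / 16 ≤ φ (x (t + 1) - (A T).toEuclideanLin (x t)) := by
    intro t
    have hAx : ‖(A T).toEuclideanLin (x t)‖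
        ≤ ‖Matrix.toEuclideanCLM (n := Fin n) (𝕜 := ℝ) (A T)‖ * M :=
      ((Matrix.toEuclideanCLM (n := Fin n) (𝕜 := ℝ) (A T)).le_opNorm (x t)).trans
        (by gcongr; exact hx t)
    have hA1 := hm3.le.trans (min_le_left _ _)
    have hA2 := hm3.le.trans (min_le_right _ _)
    have hin : ‖x (t + 1) - (A T).toEuclideanLin (x t)‖ ≤ 2 * M := by
      have : ‖Matrix.toEuclideanCLM (n := Fin n) (𝕜 := ℝ) (A T)‖ * M ≤ 1 * M := by gcongr
      linarith [norm_sub_le (x (t + 1)) ((A T).toEuclideanLin (x t)), hx (t + 1)]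
    have h := hK.dist_le_mul (x (t + 1)) (by simpa using (hx _).trans (by linarith)) _
      (by simpa using hin)
    rw [Real.dist_eq, dist_eq_norm, sub_sub_cancel] at h
    have h2 : (K : ℝ) * ‖(A T).toEuclideanLin (x t)‖ ≤ δ / 16 := by
      calc (K : ℝ) * ‖(A T).toEuclideanLin (x t)‖
          ≤ K * (δ / (16 * (K * M + 1)) * M) := by gcongr; exact hAx.trans (by gcongr)
        _ = δ / 16 * ((K * M) / (K * M + 1)) := by field_simp
        _ ≤ δ / 16 * 1 := by
            gcongr
            exact (div_le_one (by positivity)).2 (by linarith)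
        _ = δ / 16 := mul_one _
    linarith [le_abs_self (φ (x (t + 1)) - φ (x (t + 1) - (A T).toEuclideanLin (x t)))]
  have hsum : ∑ t ∈ Finset.range T, (φ (x (t + 1)) - δ / 16)
      ≤ ∑ t ∈ Finset.range T, φ (x (t + 1) - (A T).toEuclideanLin (x t)) :=
    Finset.sum_le_sum fun t _ => hterm t
  rw [lt_div_iff₀ hmpos, Finset.sum_sub_distrib] at hm2
  rw [Finset.sum_sub_distrib, Finset.sum_const, Finset.card_range, nsmul_eq_mul] at hsum
  simp only [toEuclideanLin_smul_one] at hmin'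
  nlinarith

/-- Small multiples of the identity are feasible. -/
lemma eventually_smul_one_mem_feasibleSet (N : Seminorm ℝ (Matrix (Fin n) (Fin n) ℝ)) {R : ℝ≥0∞}
    (hR : 0 < R) :
    ∀ᶠ a : ℝ in 𝓝 0, a • (1 : Matrix (Fin n) (Fin n) ℝ) ∈ feasibleSet N R := by
  have h : Tendsto (fun a : ℝ => ENNReal.ofReal (|a| * N 1)) (𝓝 0) (𝓝 0) := by
    have : Continuous fun a : ℝ => ENNReal.ofReal (|a| * N 1) :=
      ENNReal.continuous_ofReal.comp (by fun_prop)
    simpa using this.tendsto 0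
  filter_upwards [h.eventually_le_const hR] with a ha
  rw [feasibleSet, Set.mem_ofPred_eq, map_smul_eq_mul]
  exact ha

end Consistency

/-! ### The attacked trajectory -/

section Trajectory

variable {n : ℕ} {Ω : Type*}

/-- The trajectory of the system `Ā = 0` under the odd-time attack of size `c`. -/
noncomputable def attackedState (c : ℝ) (x₀ : Ω → State n) (w : ℕ → Ω → State n)
    (ξ : ℕ → Fin n → Ω → Bool) : ℕ → Ω → State n
  | 0 => x₀
  -- `oddAttack` reads its trajectory only at time `t`, so a constant sequence may stand in for it
  -- and the recursion is structural.
  | t + 1 => fun ω => w t ω + oddAttack c ξ (fun _ => attackedState c x₀ w ξ t) t ω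

lemma attackedState_succ (c : ℝ) (x₀ : Ω → State n) (w : ℕ → Ω → State n)
    (ξ : ℕ → Fin n → Ω → Bool) (t : ℕ) (ω : Ω) :
    attackedState c x₀ w ξ (t + 1) ω = w t ω + oddAttack c ξ (attackedState c x₀ w ξ) t ω := rfl

lemma isTrajectory_attackedState (c : ℝ) (x₀ : Ω → State n) (w : ℕ → Ω → State n)
    (ξ : ℕ → Fin n → Ω → Bool) :
    IsTrajectory 0 x₀ w (oddAttack c ξ (attackedState c x₀ w ξ)) (attackedState c x₀ w ξ) where
  init _ := rfl
  step t ω := by simp [attackedState_succ]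

lemma oddAttack_of_even (c : ℝ) (ξ : ℕ → Fin n → Ω → Bool) (x : ℕ → Ω → State n) (k : ℕ) (ω : Ω) :
    oddAttack c ξ x (2 * k) ω = 0 := by
  rw [oddAttack, if_neg]
  rintro ⟨h, -⟩
  exact Nat.not_even_iff_odd.2 h (even_two_mul k)

lemma norm_oddAttack_le {c : ℝ} (hc : 0 ≤ c) (ξ : ℕ → Fin n → Ω → Bool) (x : ℕ → Ω → State n)
    (t : ℕ) (ω : Ω) : ‖oddAttack c ξ x t ω‖ ≤ c := by
  rw [oddAttack]
  split_ifs
  · rw [norm_smul, norm_div, norm_norm, Real.norm_of_nonneg hc]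
    exact (div_mul_comm _ _ _).trans_le (mul_le_of_le_one_left hc (div_self_le_one _))
  · simpa using hc

lemma measurable_oddAttack {m : MeasurableSpace Ω} (c : ℝ) {ξ : ℕ → Fin n → Ω → Bool}
    {x : ℕ → Ω → State n} {t : ℕ} (hx : Measurable (x t)) (hξ : ∀ i, Measurable (ξ t i)) :
    Measurable (oddAttack c ξ x t) := by
  have hs : MeasurableSet {ω | Odd t ∧ ∀ i, ξ t i ω = true} := by
    refine (MeasurableSet.const _).inter ?_
    have : {ω | ∀ i, ξ t i ω = true} = ⋂ i, ξ t i ⁻¹' {true} := by ext; simp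
    change MeasurableSet {ω | ∀ i, ξ t i ω = true}
    rw [this]
    exact MeasurableSet.iInter fun i => hξ i (measurableSet_singleton _)
  have h1 : Measurable fun ω => (c / ‖x t ω‖) • x t ω := (hx.norm.const_div c).smul hx
  change Measurable fun ω => oddAttack c ξ x t ω
  simp only [oddAttack]
  exact Measurable.ite hs h1 measurable_const

/-- The σ-algebra `m` is left free so that it can later be the one generated by the past randomness,
which shows that the history is a function of that past. -/
lemma measurable_attackedState {m : MeasurableSpace Ω} (c : ℝ) {x₀ : Ω → State n}
    {w : ℕ → Ω → State n} {ξ : ℕ → Fin n → Ω → Bool} (hx₀ : Measurable x₀) {t : ℕ}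
    (hw : ∀ s < t, Measurable (w s)) (hξ : ∀ s < t, ∀ i, Measurable (ξ s i)) :
    ∀ s ≤ t, Measurable (attackedState c x₀ w ξ s) := by
  intro s hs
  induction s with
  | zero => exact hx₀
  | succ s ih =>
    exact (hw s hs).add (measurable_oddAttack c (ih (by omega)) (hξ s hs))

lemma norm_attackedState_succ_le {c : ℝ} (hc : 0 ≤ c) (x₀ : Ω → State n) {w : ℕ → Ω → State n}
    (ξ : ℕ → Fin n → Ω → Bool) {B : ℝ} {t : ℕ} {ω : Ω} (hw : ‖w t ω‖ ≤ B) :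
    ‖attackedState c x₀ w ξ (t + 1) ω‖ ≤ B + c :=
  (norm_add_le _ _).trans (add_le_add hw (norm_oddAttack_le hc _ _ _ _))

lemma history_le {m : MeasurableSpace Ω} {x : ℕ → Ω → State n} {t : ℕ}
    (hx : ∀ s ≤ t, Measurable (x s)) : history x t ≤ m :=
  iSup₂_le fun s hs => (hx s hs).comap_le

lemma measurable_history (x : ℕ → Ω → State n) {s t : ℕ} (h : s ≤ t) :
    Measurable[history x t] (x s) := by
  rw [measurable_iff_comap_le]
  exact le_iSup₂ (f := fun s (_ : s ∈ Set.Iic t) =>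
    MeasurableSpace.comap (x s) (inferInstance : MeasurableSpace (State n))) s h

lemma measurable_attackTimes (ξ : ℕ → Fin n → Ω → Bool) (t : ℕ) (i : Fin n) :
    Measurable[attackTimes ξ t] (ξ t i) :=
  (measurable_pi_apply i).comp (comap_measurable (fun ω i => ξ t i ω))

end Trajectory

/-! ### Moments of bounded and symmetric random vectors -/

section SubGaussian

variable {n : ℕ} {Ω : Type*} [mΩ : MeasurableSpace Ω] {P : Measure Ω}

lemma PsiTwoLE.mono {Y : Ω → State n} {K K' : ℝ} (h : PsiTwoLE P Y K) (hK : K ≤ K') :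
    PsiTwoLE P Y K' := by
  obtain ⟨hK0, hY, h⟩ := h
  refine ⟨hK0.trans_le hK, hY, fun u hu => le_trans (lintegral_mono fun ω => ?_) (h u hu)⟩
  gcongr

lemma exp_inner_sq_div_le_two {u y : State n} {b K : ℝ} (hu : ‖u‖ = 1) (hb : 0 ≤ b) (hy : ‖y‖ ≤ b)
    (hK : 0 < K) (hbK : 2 * b ≤ K) :
    ENNReal.ofReal (Real.exp ((inner ℝ u y) ^ 2 / K ^ 2)) ≤ 2 := by
  have h1 : |inner ℝ u y| ≤ b := (abs_real_inner_le_norm u y).trans (by rw [hu, one_mul]; exact hy)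
  have h2 : (inner ℝ u y) ^ 2 ≤ b ^ 2 := sq_le_sq' (abs_le.1 h1).1 (abs_le.1 h1).2
  have h3 : (inner ℝ u y) ^ 2 / K ^ 2 ≤ 1 / 4 := by
    rw [div_le_iff₀ (by positivity)]
    nlinarith
  have h4 : (1 / 4 : ℝ) ≤ Real.log 2 := by linarith [Real.log_two_gt_d9]
  have h5 : Real.exp ((inner ℝ u y) ^ 2 / K ^ 2) ≤ 2 := by
    rw [← Real.le_log_iff_exp_le two_pos]
    exact h3.trans h4
  simpa using ENNReal.ofReal_le_ofReal h5

variable [IsProbabilityMeasure P]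

lemma psiTwoLE_of_ae_bounded {Y : Ω → State n} {b K : ℝ} (hY : AEMeasurable Y P) (hb : 0 ≤ b)
    (hYb : ∀ᵐ ω ∂P, ‖Y ω‖ ≤ b) (hK : 0 < K) (hbK : 2 * b ≤ K) : PsiTwoLE P Y K := by
  refine ⟨hK, hY, fun u hu => ?_⟩
  calc _ ≤ ∫⁻ _, 2 ∂P := lintegral_mono_ae (by
        filter_upwards [hYb] with ω hω using exp_inner_sq_div_le_two hu hb hω hK hbK)
    _ = 2 := by simp

lemma condPsiTwoLE_of_ae_bounded {Y : Ω → State n} {b K : ℝ} (hY : AEMeasurable Y P)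
    (hb : 0 ≤ b) (hYb : ∀ᵐ ω ∂P, ‖Y ω‖ ≤ b) (hK : 0 < K) (hbK : 2 * b ≤ K)
    {m : MeasurableSpace Ω} (hm : m ≤ mΩ) : CondPsiTwoLE (mΩ := mΩ) P m Y K := by
  refine ⟨hK, hY, hm, fun u hu => ?_⟩
  have h : (fun ω => ENNReal.ofReal (Real.exp ((inner ℝ u (Y ω)) ^ 2 / K ^ 2)))
      ≤ᵐ[P] fun _ => 2 := by
    filter_upwards [hYb] with ω hω using exp_inner_sq_div_le_two hu hb hω hK hbK
  have h2 := condLExp_mono (mΩ := m) h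
  rw [condLExp_const hm] at h2
  exact h2

end SubGaussian

section Symmetric

variable {n : ℕ} {Ω : Type*} [MeasurableSpace Ω] {P : Measure Ω}

lemma integral_eq_zero_of_map_neg {W : Ω → State n} (hW : Measurable W)
    (hsymm : (P.map W).map (fun z => -z) = P.map W) : ∫ ω, W ω ∂P = 0 := by
  have h1 : ∫ ω, W ω ∂P = ∫ z, z ∂(P.map W) :=
    (integral_map hW.aemeasurable aestronglyMeasurable_id).symm
  have h2 : ∫ z, z ∂(P.map W) = -∫ z, z ∂(P.map W) := by
    conv_lhs => rw [← hsymm]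
    rw [integral_map (f := fun z => z) (by fun_prop) aestronglyMeasurable_id, integral_neg]
  have h3 : (2 : ℝ) • ∫ z, z ∂(P.map W) = 0 := by
    rw [two_smul]
    nth_rw 1 [h2]
    exact neg_add_cancel _
  rw [h1]
  exact (smul_eq_zero.1 h3).resolve_left two_ne_zero

end Symmetric

/-! ### Admissibility of the attack -/

section Admissible

variable {n : ℕ} {Ω : Type*} [mΩ : MeasurableSpace Ω] {P : Measure Ω} [IsProbabilityMeasure P]
  {x₀ : Ω → State n} {w : ℕ → Ω → State n} {ξ : ℕ → Fin n → Ω → Bool}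

lemma indep_noise_history (c : ℝ) (hx₀ : Measurable x₀) (hw : ∀ t, Measurable (w t))
    (hξ : ∀ t i, Measurable (ξ t i)) (hw_indep : iIndepFun w P)
    (hwξ : IndepFun (fun ω t => w t ω) (fun ω t i => ξ t i ω) P)
    (hx₀wξ : IndepFun x₀ (fun ω => (fun t => w t ω, fun t i => ξ t i ω)) P) (t : ℕ) :
    Indep (MeasurableSpace.comap (w t) inferInstance)
      (history (attackedState c x₀ w ξ) t ⊔
        history (oddAttack c ξ (attackedState c x₀ w ξ)) t) P := by
  have hpast : Measurable fun ω (s : Finset.range t) => w s ω :=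
    measurable_pi_lambda _ fun s => hw s
  have hall : Measurable fun ω t i => ξ t i ω :=
    measurable_pi_lambda _ fun t => measurable_pi_lambda _ fun i => hξ t i
  have hev : Measurable fun f : ({t} : Finset ℕ) → State n => f ⟨t, Finset.mem_singleton_self t⟩ :=
    measurable_pi_apply _
  have h1 : IndepFun (w t) (fun ω (s : Finset.range t) => w s ω) P :=
    (hw_indep.indepFun_finset {t} (Finset.range t) (by simp) hw).comp hev measurable_id
  have h2 : IndepFun (w t) (fun ω => ((fun s : Finset.range t => w s ω), fun t i => ξ t i ω)) P :=
    indepFun_prodMk_right (hw t) hpast hall h1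
      (hwξ.comp (φ := fun f => (f t, fun s : Finset.range t => f s)) (by fun_prop) measurable_id)
  have h3 : IndepFun (w t)
      (fun ω => (((fun s : Finset.range t => w s ω), fun t i => ξ t i ω), x₀ ω)) P :=
    indepFun_prodMk_right (hw t) (hpast.prodMk hall) hx₀ h2
      (hx₀wξ.symm.comp (φ := fun q => (q.1 t, ((fun s : Finset.range t => q.1 s), q.2)))
        (by fun_prop) measurable_id)
  -- States and attacks up to time `t` are functions of `past`. All indicators are included because
  -- the attack at time `t` uses those of time `t`.
  set past := fun ω => (((fun s : Finset.range t => w s ω), fun t i => ξ t i ω), x₀ ω) with hp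
  have hpm : Measurable[MeasurableSpace.comap past inferInstance] past := comap_measurable past
  refine indep_of_indep_of_le_right (IndepFun_iff_Indep _ _ _ |>.1 h3) ?_
  have hmw : ∀ s < t, Measurable[MeasurableSpace.comap past inferInstance] (w s) := fun s hs =>
    Measurable.comp (g := fun q : ((Finset.range t → State n) × (ℕ → Fin n → Bool)) × State n =>
      q.1.1 ⟨s, Finset.mem_range.2 hs⟩) (by fun_prop) hpm
  have hmξ : ∀ s i, Measurable[MeasurableSpace.comap past inferInstance] (ξ s i) := fun s i =>
    Measurable.comp (g := fun q : ((Finset.range t → State n) × (ℕ → Fin n → Bool)) × State n =>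
      q.1.2 s i) (by fun_prop) hpm
  have hm0 : Measurable[MeasurableSpace.comap past inferInstance] x₀ := measurable_snd.comp hpm
  have hmx := measurable_attackedState c hm0 hmw (fun s _ => hmξ s)
  exact sup_le (history_le hmx)
    (history_le fun s hs => measurable_oddAttack c (hmx s hs) (hmξ s))

lemma indep_attackTimes_history (c : ℝ) (hx₀ : Measurable x₀) (hw : ∀ t, Measurable (w t))
    (hξ : ∀ t i, Measurable (ξ t i))
    (hξ_indep : iIndepFun (fun k : ℕ × Fin n => ξ k.1 k.2) P)
    (hwξ : IndepFun (fun ω t => w t ω) (fun ω t i => ξ t i ω) P)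
    (hx₀wξ : IndepFun x₀ (fun ω => (fun t => w t ω, fun t i => ξ t i ω)) P) (t : ℕ) :
    Indep (attackTimes ξ t) (history (attackedState c x₀ w ξ) t) P := by
  -- The state at time `t` involves only indicators at earlier times, so those at time `t` can be
  -- left out of the past.
  set S : Finset (ℕ × Fin n) := Finset.range t ×ˢ Finset.univ with hS
  have hnow : Measurable fun ω i => ξ t i ω := measurable_pi_lambda _ fun i => hξ t i
  have hpast : Measurable fun ω (k : S) => ξ k.1.1 k.1.2 ω :=
    measurable_pi_lambda _ fun k => hξ _ _
  have hall : Measurable fun ω t => w t ω := measurable_pi_lambda _ fun t => hw t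
  have h1 : IndepFun (fun ω i => ξ t i ω) (fun ω (k : S) => ξ k.1.1 k.1.2 ω) P := by
    refine (hξ_indep.indepFun_finset ({t} ×ˢ Finset.univ) S ?_ fun k => hξ _ _).comp
      (φ := fun f i => f ⟨(t, i), by simp⟩)
      (measurable_pi_lambda _ fun i => measurable_pi_apply _) measurable_id
    rw [Finset.disjoint_left]
    rintro ⟨s, i⟩ h1 h2
    simp [hS] at h1 h2
    omega
  have h2 : IndepFun (fun ω i => ξ t i ω)
      (fun ω => ((fun k : S => ξ k.1.1 k.1.2 ω), fun t => w t ω)) P :=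
    indepFun_prodMk_right hnow hpast hall h1
      (hwξ.symm.comp (φ := fun f => (f t, fun k : S => f k.1.1 k.1.2)) (by fun_prop) measurable_id)
  have h3 : IndepFun (fun ω i => ξ t i ω)
      (fun ω => (((fun k : S => ξ k.1.1 k.1.2 ω), fun t => w t ω), x₀ ω)) P :=
    indepFun_prodMk_right hnow (hpast.prodMk hall) hx₀ h2
      (hx₀wξ.symm.comp (φ := fun q => (q.2 t, ((fun k : S => q.2 k.1.1 k.1.2), q.1)))
        (by fun_prop) measurable_id)
  set past := fun ω => (((fun k : S => ξ k.1.1 k.1.2 ω), fun t => w t ω), x₀ ω) with hp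
  have hpm : Measurable[MeasurableSpace.comap past inferInstance] past := comap_measurable past
  refine indep_of_indep_of_le_right (IndepFun_iff_Indep _ _ _ |>.1 h3) ?_
  refine history_le (measurable_attackedState c ?_ ?_ ?_)
  · exact measurable_snd.comp hpm
  · exact fun s _ => Measurable.comp
      (g := fun q : ((S → Bool) × (ℕ → State n)) × State n => q.1.2 s) (by fun_prop) hpm
  · exact fun s hs i => Measurable.comp
      (g := fun q : ((S → Bool) × (ℕ → State n)) × State n =>
        q.1.1 ⟨(s, i), by simp [hS, hs]⟩) (by fun_prop) hpm

lemma subGaussianNoiseAttack_oddAttack {c : ℝ} (hc : 0 < c) (hx₀ : Measurable x₀)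
    (hx₀_subG : ∃ K : ℝ, PsiTwoLE P x₀ K) (hw : ∀ t, Measurable (w t))
    {ν : Measure (State n)} (hν : IsBddSymmAC ν) (hw_law : ∀ t, P.map (w t) = ν)
    (hw_indep : iIndepFun w P) (hξ : ∀ t i, Measurable (ξ t i))
    (hwξ : IndepFun (fun ω t => w t ω) (fun ω t i => ξ t i ω) P)
    (hx₀wξ : IndepFun x₀ (fun ω => (fun t => w t ω, fun t i => ξ t i ω)) P)
    {B : ℝ} (hB : 0 ≤ B) (hwB : ∀ t, ∀ᵐ ω ∂P, ‖w t ω‖ ≤ B) :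
    SubGaussianNoiseAttack P ξ w (oddAttack c ξ (attackedState c x₀ w ξ))
      (attackedState c x₀ w ξ) := by
  have hmx : ∀ t, Measurable (attackedState c x₀ w ξ t) := fun t =>
    measurable_attackedState c hx₀ (fun s _ => hw s) (fun s _ => hξ s) t le_rfl
  refine ⟨fun t => ?_, ?_, fun t => ⟨?_, ?_⟩, hw_indep,
    indep_noise_history c hx₀ hw hξ hw_indep hwξ hx₀wξ, 2 * B + 1, fun t => ?_⟩
  · exact measurable_oddAttack c ((measurable_history _ le_rfl).mono le_sup_left le_rfl)
      fun i => (measurable_attackTimes ξ t i).mono le_sup_right le_rfl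
  · obtain ⟨K, hK⟩ := hx₀_subG
    refine ⟨max K (2 * c), fun t => ?_, hK.mono (le_max_left _ _)⟩
    exact condPsiTwoLE_of_ae_bounded (measurable_oddAttack c (hmx t) (hξ t)).aemeasurable hc.le
      (.of_forall fun ω => norm_oddAttack_le hc.le _ _ _ _)
      (hK.1.trans_le (le_max_left _ _)) (le_max_right _ _) (history_le fun s _ => hmx s)
  · exact Integrable.of_bound (hw t).aestronglyMeasurable B (hwB t)
  · exact integral_eq_zero_of_map_neg (hw t) (by rw [hw_law]; exact hν.symm)
  · exact psiTwoLE_of_ae_bounded (hw t).aemeasurable hB (hwB t) (by positivity) (by linarith)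

lemma nodewiseAttack_oddAttack {p : ℝ} (c : ℝ) (hx₀ : Measurable x₀) (hw : ∀ t, Measurable (w t))
    (hξ : ∀ t i, Measurable (ξ t i))
    (hξ_law : ∀ t i, P {ω | ξ t i ω = true} = ENNReal.ofReal p)
    (hξ_indep : iIndepFun (fun k : ℕ × Fin n => ξ k.1 k.2) P)
    (hwξ : IndepFun (fun ω t => w t ω) (fun ω t i => ξ t i ω) P)
    (hx₀wξ : IndepFun x₀ (fun ω => (fun t => w t ω, fun t i => ξ t i ω)) P) :
    NodewiseAttack P p ξ (oddAttack c ξ (attackedState c x₀ w ξ)) (attackedState c x₀ w ξ) := by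
  refine ⟨hξ, hξ_law, hξ_indep,
    indep_attackTimes_history c hx₀ hw hξ hξ_indep hwξ hx₀wξ, fun t i ω h => ?_⟩
  rw [oddAttack, if_neg fun hall => by simp [hall.2 i] at h]
  rfl

end Admissible

/-! ### Blocks of one odd and one even step -/

section Block

variable {n : ℕ}

/-- The state reached from `q.1 0` after one attacked step with noise `q.1 1` and indicators
`q.2`. -/
noncomputable def blockState (c : ℝ) (q : (Fin 3 → State n) × (Fin n → Bool)) : State n :=
  q.1 1 + if ∀ i, q.2 i = true then (c / ‖q.1 0‖) • q.1 0 else 0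

/-- The decrease of the loss over two consecutive steps when `0` is replaced by `a • 1`. -/
noncomputable def blockGain (φ : State n → ℝ) (c a : ℝ) (q : (Fin 3 → State n) × (Fin n → Bool)) : ℝ :=
  (φ (blockState c q) - φ (blockState c q - a • q.1 0))
    + (φ (q.1 2) - φ (q.1 2 - a • blockState c q))

lemma measurableSet_forall_eq_true : MeasurableSet {b : Fin n → Bool | ∀ i, b i = true} :=
  (Set.toFinite _).measurableSet

lemma measurable_blockState (c : ℝ) : Measurable (blockState (n := n) c) := by
  have h0 : Measurable fun q : (Fin 3 → State n) × (Fin n → Bool) => q.1 0 := by fun_prop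
  refine Measurable.add (by fun_prop) (Measurable.ite ?_ ?_ measurable_const)
  · exact measurable_snd measurableSet_forall_eq_true
  · exact (h0.norm.const_div c).smul h0

lemma measurable_blockGain {φ : State n → ℝ} (hφ : Continuous φ) (c a : ℝ) :
    Measurable (blockGain φ c a) := by
  have h0 : Measurable fun q : (Fin 3 → State n) × (Fin n → Bool) => q.1 0 := by fun_prop
  have h2 : Measurable fun q : (Fin 3 → State n) × (Fin n → Bool) => q.1 2 := by fun_prop
  have hs := measurable_blockState (n := n) c
  exact ((hφ.measurable.comp hs).sub (hφ.measurable.comp (hs.sub (h0.const_smul a)))).add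
    ((hφ.measurable.comp h2).sub (hφ.measurable.comp (h2.sub (hs.const_smul a))))

lemma norm_blockState_le {c B : ℝ} (hc : 0 ≤ c) {q : (Fin 3 → State n) × (Fin n → Bool)}
    (hq : ‖q.1 1‖ ≤ B) : ‖blockState c q‖ ≤ B + c := by
  refine (norm_add_le _ _).trans (add_le_add hq ?_)
  split_ifs
  · rw [norm_smul, norm_div, norm_norm, Real.norm_of_nonneg hc]
    exact (div_mul_comm _ _ _).trans_le (mul_le_of_le_one_left hc (div_self_le_one _))
  · simpa using hc

lemma attackedState_odd {Ω : Type*} (c : ℝ) (x₀ : Ω → State n) (w : ℕ → Ω → State n)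
    (ξ : ℕ → Fin n → Ω → Bool) (k : ℕ) (ω : Ω) :
    attackedState c x₀ w ξ (2 * k + 1) ω = w (2 * k) ω := by
  rw [attackedState_succ, oddAttack_of_even, add_zero]

lemma attackedState_even {Ω : Type*} (c : ℝ) (x₀ : Ω → State n) (w : ℕ → Ω → State n)
    (ξ : ℕ → Fin n → Ω → Bool) (k : ℕ) (ω : Ω) :
    attackedState c x₀ w ξ (2 * k + 2) ω
      = blockState c (fun i => w (2 * k + i) ω, fun i => ξ (2 * k + 1) i ω) := by
  rw [attackedState_succ, oddAttack, attackedState_odd, blockState]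
  simp only [odd_two_mul_add_one, true_and, Fin.val_one, Fin.val_zero, add_zero]

/-- Attacks of a large enough size increase the loss by at least one. -/
lemma IsStandardLoss.exists_attack_size {φ : State n → ℝ} (hφ : IsStandardLoss φ) (B : ℝ) :
    ∃ c > 0, ∃ M, (∀ y : State n, ‖y‖ ≤ B → φ y ≤ M) ∧
      ∀ y x : State n, ‖y‖ ≤ B → x ≠ 0 → M + 1 ≤ φ (y + (c / ‖x‖) • x) := by
  obtain ⟨M, hM⟩ := (isCompact_closedBall (0 : State n) B).bddAbove_image
    hφ.convex.locallyLipschitz.continuous.continuousOn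
  obtain ⟨r, -, hr⟩ := (hasBasis_cobounded_norm.eventually_iff).1
    (hφ.coercive.eventually_ge_atTop (M + 1))
  -- `M` bounds `φ` on the noise ball and `φ ≥ M + 1` at norm `r` or more; a jump of this length
  -- from the noise ball lands there.
  refine ⟨|r| + |B| + 1, by positivity, M,
    fun y hy => hM ⟨y, by simpa using hy, rfl⟩, fun y x hy hx => hr ?_⟩
  have hx' : ‖x‖ ≠ 0 := norm_ne_zero_iff.2 hx
  have h1 : ‖((|r| + |B| + 1) / ‖x‖) • x‖ = |r| + |B| + 1 := by
    rw [norm_smul, norm_div, norm_norm, div_mul_cancel₀ _ hx']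
    exact Real.norm_of_nonneg (by positivity)
  have h2 := norm_sub_le (y + ((|r| + |B| + 1) / ‖x‖) • x) y
  rw [add_sub_cancel_left, h1] at h2
  change r ≤ _
  linarith [le_abs_self r, le_abs_self B]

end Block

/-! ### Expected gain of a small multiple of the identity -/

section ExpectedGain

variable {n : ℕ} {Ω : Type*} [MeasurableSpace Ω] {P : Measure Ω} [IsProbabilityMeasure P]

lemma integrable_comp_of_ae_bounded {φ : State n → ℝ} (hφ : Continuous φ) {Z : Ω → State n}
    (hZ : Measurable Z) {r : ℝ} (hr : ∀ᵐ ω ∂P, ‖Z ω‖ ≤ r) : Integrable (fun ω => φ (Z ω)) P := by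
  obtain ⟨C, hC⟩ := (isCompact_closedBall (0 : State n) r).exists_bound_of_continuousOn
    hφ.continuousOn
  refine Integrable.of_bound (hφ.measurable.comp hZ).aestronglyMeasurable C ?_
  filter_upwards [hr] with ω hω using hC _ (by simpa using hω)

/-- If the attack is strong enough, then for small `a > 0` the matrix `a • 1` has a strictly smaller
expected loss than `0` over two consecutive steps: at the attacked step it gains order `a`, and
elsewhere it loses `o(a)` since the noise is symmetric and absolutely continuous. -/
lemma integrable_and_eventually_integral_blockGain_pos {φ : State n → ℝ} (hφ : IsStandardLoss φ)
    {ν : Measure (State n)} (hν : IsBddSymmAC ν) (hn : 0 < n)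
    {W : Fin 3 → Ω → State n} (hW : ∀ i, Measurable (W i)) (hlaw : ∀ i, P.map (W i) = ν)
    {b : Ω → Fin n → Bool} (hb : Measurable b)
    (h1 : IndepFun (W 1) (fun ω => (W 0 ω, b ω)) P)
    (h2 : IndepFun (W 2) (fun ω => ((W 0 ω, W 1 ω), b ω)) P)
    (hpos : P {ω | ∀ i, b ω i = true} ≠ 0)
    {B c M : ℝ} (hB : ∀ i, ∀ᵐ ω ∂P, ‖W i ω‖ ≤ B) (hc : 0 < c)
    (hM : ∀ y : State n, ‖y‖ ≤ B → φ y ≤ M)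
    (hcM : ∀ y x : State n, ‖y‖ ≤ B → x ≠ 0 → M + 1 ≤ φ (y + (c / ‖x‖) • x)) :
    (∀ a, Integrable (fun ω => blockGain φ c a (fun i => W i ω, b ω)) P) ∧
    ∀ᶠ a in 𝓝[>] (0 : ℝ), 0 < ∫ ω, blockGain φ c a (fun i => W i ω, b ω) ∂P := by
  have hφc : Continuous φ := hφ.convex.locallyLipschitz.continuous
  have hW' : Measurable fun ω => ((fun i => W i ω), b ω) :=
    (measurable_pi_lambda _ fun i => hW i).prodMk hb
  set X : Ω → State n := fun ω => blockState c (fun i => W i ω, b ω) with hX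
  have hXm : Measurable X := (measurable_blockState c).comp hW'
  have hXB : ∀ᵐ ω ∂P, ‖X ω‖ ≤ B + c := by
    filter_upwards [hB 1] with ω hω using norm_blockState_le hc.le hω
  have hB0 : 0 ≤ B := by
    obtain ⟨ω, hω⟩ := (hB 0).exists
    exact (norm_nonneg _).trans hω
  set S : Set Ω := {ω | ∀ i, b ω i = true} with hS
  have hSm : MeasurableSet S := hb measurableSet_forall_eq_true
  -- `Y` is the shift with attacked outcomes removed, so `tendsto_integral_shift` governs exactly
  -- the unattacked part of the first step.
  set Y : Ω → State n := Sᶜ.indicator (W 0) with hY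
  have hYm : Measurable Y := (hW 0).indicator hSm.compl
  have hYB : ∀ᵐ ω ∂P, ‖Y ω‖ ≤ B := by
    filter_upwards [hB 0] with ω hω using (norm_indicator_le_norm_self _ _).trans hω
  have hshift : ∀ {U V : Ω → State n}, Measurable U → Measurable V → ∀ {r s : ℝ},
      (∀ᵐ ω ∂P, ‖U ω‖ ≤ r) → (∀ᵐ ω ∂P, ‖V ω‖ ≤ s) → ∀ a : ℝ,
      Integrable (fun ω => φ (U ω - a • V ω)) P := by
    intro U V hU hV r s hr hs a
    refine integrable_comp_of_ae_bounded hφc (hU.sub (hV.const_smul a)) (r := r + |a| * s) ?_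
    filter_upwards [hr, hs] with ω h3 h4
    refine (norm_sub_le _ _).trans (add_le_add h3 ?_)
    rw [norm_smul, Real.norm_eq_abs]
    gcongr
  have hint2 : ∀ a : ℝ, Integrable (fun ω => φ (W 2 ω - a • X ω) - φ (W 2 ω)) P := fun a =>
    (hshift (hW 2) hXm (hB 2) hXB a).sub (integrable_comp_of_ae_bounded hφc (hW 2) (hB 2))
  have hint1 : ∀ a : ℝ, Integrable (fun ω => φ (W 1 ω - a • Y ω) - φ (W 1 ω)) P := fun a =>
    (hshift (hW 1) hYm (hB 1) hYB a).sub (integrable_comp_of_ae_bounded hφc (hW 1) (hB 1))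
  have hint : ∀ a, Integrable (fun ω => blockGain φ c a (fun i => W i ω, b ω)) P := fun a =>
    ((integrable_comp_of_ae_bounded hφc hXm hXB).sub (hshift hXm (hW 0) hXB (hB 0) a)).add
      ((integrable_comp_of_ae_bounded hφc (hW 2) (hB 2)).sub (hshift (hW 2) hXm (hB 2) hXB a))
  refine ⟨hint, ?_⟩
  have hW1Y : IndepFun (W 1) Y P := by
    have hg : Measurable fun q : State n × (Fin n → Bool) =>
        {q : State n × (Fin n → Bool) | ∀ i, q.2 i = true}ᶜ.indicator Prod.fst q :=
      measurable_fst.indicator (measurable_snd measurableSet_forall_eq_true).compl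
    exact h1.comp measurable_id hg
  have hW2X : IndepFun (W 2) X P := by
    have hg : Measurable fun q : (State n × State n) × (Fin n → Bool) =>
        -- `blockState` ignores the third noise, so `0` serves as filler.
        blockState c (![q.1.1, q.1.2, 0], q.2) := by
      refine (measurable_blockState c).comp (Measurable.prodMk ?_ measurable_snd)
      refine measurable_pi_lambda _ fun i => ?_
      fin_cases i
      · exact measurable_fst.fst
      · exact measurable_fst.snd
      · exact measurable_const
    exact h2.comp measurable_id hg
  have hlim1 := tendsto_integral_shift (μ := volume) hφ.convex hφ.even (hW 1) hYm hW1Y (hB 1) hYB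
    (by rw [hlaw]; exact hν.symm) (by rw [hlaw]; exact hν.absCont)
  have hlim2 := tendsto_integral_shift (μ := volume) hφ.convex hφ.even (hW 2) hXm hW2X
    (B := B + c) ((hB 2).mono fun ω h => by linarith) hXB
    (by rw [hlaw]; exact hν.symm) (by rw [hlaw]; exact hν.absCont)
  have hZint : Integrable (S.indicator fun ω => ‖W 0 ω‖ / c) P := by
    refine Integrable.indicator (Integrable.div_const ?_ c) hSm
    exact (Integrable.of_bound (hW 0).aestronglyMeasurable B (hB 0)).norm
  have hκ : 0 < ∫ ω, S.indicator (fun ω => ‖W 0 ω‖ / c) ω ∂P := by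
    rw [integral_pos_iff_support_of_nonneg_ae
      (.of_forall fun ω => Set.indicator_nonneg (fun _ _ => by positivity) ω) hZint]
    -- For `n > 0` Lebesgue measure has no atom at `0`, hence neither has the noise law.
    have hne : ∀ᵐ ω ∂P, W 0 ω ≠ 0 := by
      have : Nonempty (Fin n) := ⟨⟨0, hn⟩⟩
      have : ∀ᵐ z ∂ν, z ≠ 0 := hν.absCont.ae_le (Measure.ae_ne volume 0)
      rw [← hlaw 0] at this
      exact ae_of_ae_map (hW 0).aemeasurable this
    refine (pos_iff_ne_zero.2 hpos).trans_le (measure_mono_ae ?_)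
    filter_upwards [hne] with ω hω hωS
    change S.indicator (fun ω => ‖W 0 ω‖ / c) ω ≠ 0
    rw [Set.indicator_of_mem (show ω ∈ S from hωS)]
    exact div_ne_zero (norm_ne_zero_iff.2 hω) hc.ne'
  have hlim := hlim1.add hlim2
  rw [add_zero] at hlim
  -- This range gives `a * ‖W 0 ω‖ ≤ c`: the shift does not overshoot the unattacked point.
  have hsmall : ∀ᶠ a : ℝ in 𝓝[>] 0, 0 < a ∧ a ≤ c / (B + 1) := by
    filter_upwards [Ioc_mem_nhdsGT (show (0 : ℝ) < c / (B + 1) by positivity)] with a ha using ha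
  filter_upwards [hlim.eventually_lt_const hκ, hsmall] with a hlt ha
  have hac : a * (B + 1) ≤ c := (le_div_iff₀ (by positivity)).1 ha.2
  have hpt : ∀ᵐ ω ∂P, a * S.indicator (fun ω => ‖W 0 ω‖ / c) ω
      - (φ (W 1 ω - a • Y ω) - φ (W 1 ω)) - (φ (W 2 ω - a • X ω) - φ (W 2 ω))
      ≤ blockGain φ c a (fun i => W i ω, b ω) := by
    filter_upwards [hB 0, hB 1] with ω hω0 hω1
    have key : a * S.indicator (fun ω => ‖W 0 ω‖ / c) ω - (φ (W 1 ω - a • Y ω) - φ (W 1 ω))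
        ≤ φ (X ω) - φ (X ω - a • W 0 ω) := by
      by_cases hωS : ω ∈ S
      · have hXω : X ω = W 1 ω + (c / ‖W 0 ω‖) • W 0 ω := by
          simp only [hX, blockState]
          exact congrArg (W 1 ω + ·) (if_pos hωS)
        rw [Set.indicator_of_mem hωS, hY, Set.indicator_of_notMem (by simpa using hωS), smul_zero,
          sub_zero, sub_self, sub_zero, hXω]
        by_cases h0 : W 0 ω = 0
        · simp [h0]
        · have := convexOn_sub_smul_le hφ.convex h0 hc ha.1.le
            ((mul_le_mul_of_nonneg_left (by linarith) ha.1.le).trans hac) (hM _ hω1) (hcM _ _ hω1 h0)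
          rw [← mul_div_assoc]
          linarith
      · have hXω : X ω = W 1 ω := by
          simp only [hX, blockState]
          exact (congrArg (W 1 ω + ·) (if_neg hωS)).trans (add_zero _)
        rw [Set.indicator_of_notMem hωS, hY, Set.indicator_of_mem (by simpa using hωS), hXω]
        linarith
    simp only [blockGain]
    change _ ≤ φ (X ω) - φ (X ω - a • W 0 ω) + (φ (W 2 ω) - φ (W 2 ω - a • X ω))
    linarith
  have hle := integral_mono_ae (((hZint.const_mul a).sub (hint1 a)).sub (hint2 a)) (hint a) hpt
  refine lt_of_lt_of_le ?_ hle
  rw [integral_sub' ((hZint.const_mul a).sub (hint1 a)) (hint2 a),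
    integral_sub' (hZint.const_mul a) (hint1 a), integral_const_mul]
  rw [← mul_add, inv_mul_lt_iff₀ ha.1] at hlt
  linarith

end ExpectedGain

/-! ### Laws of the attack indicators -/

section Indicators

variable {n : ℕ} {Ω : Type*} [MeasurableSpace Ω] {P : Measure Ω}
  {ξ : ℕ → Fin n → Ω → Bool}

lemma indepFun_indicators (hξ : ∀ t i, Measurable (ξ t i))
    (hξ_indep : iIndepFun (fun k : ℕ × Fin n => ξ k.1 k.2) P) {s t : ℕ} (hst : s ≠ t) :
    IndepFun (fun ω i => ξ s i ω) (fun ω i => ξ t i ω) P := by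
  refine (hξ_indep.indepFun_finset ({s} ×ˢ Finset.univ) ({t} ×ˢ Finset.univ) ?_
    fun k => hξ _ _).comp (φ := fun f i => f ⟨(s, i), by simp⟩) (ψ := fun f i => f ⟨(t, i), by simp⟩)
      (measurable_pi_lambda _ fun i => measurable_pi_apply _)
      (measurable_pi_lambda _ fun i => measurable_pi_apply _)
  rw [Finset.disjoint_left]
  rintro ⟨r, i⟩ h1 h2
  simp only [Finset.mem_product, Finset.mem_singleton, Finset.mem_univ, and_true] at h1 h2
  exact hst (h1.symm.trans h2)

lemma measure_forall_indicators_ne_zero {p : ℝ} (hp : 0 < p)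
    (hξ_law : ∀ t i, P {ω | ξ t i ω = true} = ENNReal.ofReal p)
    (hξ_indep : iIndepFun (fun k : ℕ × Fin n => ξ k.1 k.2) P) (t : ℕ) :
    P {ω | ∀ i, ξ t i ω = true} ≠ 0 := by
  have h := (hξ_indep.precomp (g := fun i => (t, i)) (Prod.mk_right_injective t)).meas_iInter
    (s := fun i => {ω | ξ t i ω = true}) fun i => ⟨{true}, measurableSet_singleton _, rfl⟩
  have he : {ω | ∀ i, ξ t i ω = true} = ⋂ i, {ω | ξ t i ω = true} := by ext; simp
  rw [he, h]
  refine Finset.prod_ne_zero_iff.2 fun i _ => ?_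
  rw [hξ_law]
  simpa using hp

variable [IsProbabilityMeasure P]

lemma identDistrib_of_measure_true_eq {X Y : Ω → Bool} (hX : Measurable X) (hY : Measurable Y)
    (h : P {ω | X ω = true} = P {ω | Y ω = true}) : IdentDistrib X Y P P := by
  have ht : P.map X {true} = P.map Y {true} := by
    rw [Measure.map_apply hX (measurableSet_singleton _),
      Measure.map_apply hY (measurableSet_singleton _)]
    exact h
  have : IsProbabilityMeasure (P.map X) := Measure.isProbabilityMeasure_map hX.aemeasurable
  have : IsProbabilityMeasure (P.map Y) := Measure.isProbabilityMeasure_map hY.aemeasurable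
  refine ⟨hX.aemeasurable, hY.aemeasurable, Measure.ext_of_singleton fun b => ?_⟩
  cases b
  · have hf : ({false} : Set Bool) = {true}ᶜ := by ext b; cases b <;> simp
    rw [hf, prob_compl_eq_one_sub (measurableSet_singleton _),
      prob_compl_eq_one_sub (measurableSet_singleton _), ht]
  · exact ht

lemma identDistrib_indicators {p : ℝ} (hξ : ∀ t i, Measurable (ξ t i))
    (hξ_law : ∀ t i, P {ω | ξ t i ω = true} = ENNReal.ofReal p)
    (hξ_indep : iIndepFun (fun k : ℕ × Fin n => ξ k.1 k.2) P) (s t : ℕ) :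
    IdentDistrib (fun ω i => ξ s i ω) (fun ω i => ξ t i ω) P P :=
  IdentDistrib.pi (fun i => identDistrib_of_measure_true_eq (hξ s i) (hξ t i)
      ((hξ_law s i).trans (hξ_law t i).symm))
    (hξ_indep.precomp (g := fun i => (s, i)) (Prod.mk_right_injective s))
    (hξ_indep.precomp (g := fun i => (t, i)) (Prod.mk_right_injective t))

end Indicators

end SysId

/-! ### Assembly -/

open SysId in
theorem theorem1 {n : ℕ} (hn : 0 < n)
    -- the estimator: a standard convex loss, an arbitrary matrix norm, a radius in `(0, ∞]`
    (φ : State n → ℝ) (hφ : SysId.IsStandardLoss φ)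
    (N : Seminorm ℝ (Matrix (Fin n) (Fin n) ℝ)) (hN : ∀ A, N A = 0 → A = 0)
    (R : ℝ≥0∞) (hR : 0 < R)
    -- the noise law and the attack probability
    (ν : Measure (State n)) (hν : SysId.IsBddSymmAC ν)
    (p : ℝ) (hp0 : 0 < p) (hp1 : p ≤ 1)
    -- the randomness: initial state, noise and attack indicators, independent of one another
    {Ω : Type*} [MeasurableSpace Ω] (P : Measure Ω) [IsProbabilityMeasure P]
    (x₀ : Ω → State n) (hx₀ : Measurable x₀) (hx₀_subG : ∃ K : ℝ, SysId.PsiTwoLE P x₀ K)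
    (w : ℕ → Ω → State n) (hw : ∀ t, Measurable (w t)) (hw_law : ∀ t, P.map (w t) = ν)
    (hw_indep : iIndepFun w P)
    (ξ : ℕ → Fin n → Ω → Bool) (hξ : ∀ t i, Measurable (ξ t i))
    (hξ_law : ∀ t i, P {ω | ξ t i ω = true} = ENNReal.ofReal p)
    (hξ_indep : iIndepFun (fun k : ℕ × Fin n => ξ k.1 k.2) P)
    (hwξ : IndepFun (fun ω t => w t ω) (fun ω t i => ξ t i ω) P)
    (hx₀wξ : IndepFun x₀ (fun ω => (fun t => w t ω, fun t i => ξ t i ω)) P) :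
    -- for the system `Ā = 0` there is an admissible attack of the stated form ...
    ∃ c : ℝ, 0 < c ∧ ∃ v x : ℕ → Ω → State n,
      SysId.IsTrajectory 0 x₀ w v x ∧
      (∀ t ω, v t ω = SysId.oddAttack c ξ x t ω) ∧
      SysId.SubGaussianNoiseAttack P ξ w v x ∧
      SysId.NodewiseAttack P p ξ v x ∧
      -- ... under which no sequence of minimizers converges to `Ā = 0`, almost surely
      ∀ A : ℕ → Ω → Matrix (Fin n) (Fin n) ℝ,
        (∀ T, 1 ≤ T → ∀ᵐ ω ∂P, SysId.IsEstimate φ N R (fun t => x t ω) T (A T ω)) →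
        ∀ᵐ ω ∂P, ¬ Tendsto (fun T => A T ω) atTop (𝓝 (0 : Matrix (Fin n) (Fin n) ℝ)) := by
  obtain ⟨B, hBν⟩ := hν.bounded
  have hwB : ∀ t, ∀ᵐ ω ∂P, ‖w t ω‖ ≤ B := fun t =>
    ae_of_ae_map (hw t).aemeasurable (by rwa [hw_law t])
  have hB : 0 ≤ B := by
    obtain ⟨ω, hω⟩ := (hwB 0).exists
    exact (norm_nonneg _).trans hω
  obtain ⟨c, hc, M, hM, hcM⟩ := hφ.exists_attack_size B
  refine ⟨c, hc, oddAttack c ξ (attackedState c x₀ w ξ), attackedState c x₀ w ξ,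
    isTrajectory_attackedState c x₀ w ξ, fun _ _ => rfl,
    subGaussianNoiseAttack_oddAttack hc hx₀ hx₀_subG hw hν hw_law hw_indep hξ hwξ hx₀wξ hB hwB,
    nodewiseAttack_oddAttack c hx₀ hw hξ hξ_law hξ_indep hwξ hx₀wξ, fun A hA => ?_⟩
  have hξ' : ∀ t, Measurable fun ω i => ξ t i ω := fun t => measurable_pi_lambda _ fun i => hξ t i
  have hev : ∀ t, Measurable fun f : ℕ → Fin n → Bool => f t := measurable_pi_apply
  have h1 : IndepFun (w 1) (fun ω => (w 0 ω, fun i => ξ 1 i ω)) P :=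
    indepFun_prodMk_right (hw 1) (hw 0) (hξ' 1) (hw_indep.indepFun one_ne_zero)
      (hwξ.comp (φ := fun f => (f 1, f 0)) (by fun_prop) (hev 1))
  have h2 : IndepFun (w 2) (fun ω => ((w 0 ω, w 1 ω), fun i => ξ 1 i ω)) P :=
    indepFun_prodMk_right (hw 2) ((hw 0).prodMk (hw 1)) (hξ' 1)
      (hw_indep.indepFun_prodMk hw 0 1 2 (by norm_num) (by norm_num)).symm
      (hwξ.comp (φ := fun f => (f 2, (f 0, f 1))) (by fun_prop) (hev 1))
  obtain ⟨hint, hgain⟩ := integrable_and_eventually_integral_blockGain_pos hφ hν hn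
    (W := fun i => w i) (fun i => hw i) (fun i => hw_law i) (hξ' 1) h1 h2
    (measure_forall_indicators_ne_zero hp0 hξ_law hξ_indep 1) (fun i => hwB i) hc hM hcM
  obtain ⟨a, hapos, hafeas⟩ := (hgain.and ((eventually_smul_one_mem_feasibleSet N hR).filter_mono
    nhdsWithin_le_nhds)).exists
  have hwd : ∀ t, IdentDistrib (w t) (w 0) P P := fun t =>
    ⟨(hw t).aemeasurable, (hw 0).aemeasurable, (hw_law t).trans (hw_law 0).symm⟩
  have hslln := ae_tendsto_average_even_window (ξ := fun t ω i => ξ t i ω) hw hξ' hw_indep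
    (fun s t hst => indepFun_indicators hξ hξ_indep hst) hwd
    (fun t => identDistrib_indicators hξ hξ_law hξ_indep t 1) hwξ
    (measurable_blockGain hφ.convex.locallyLipschitz.continuous c a) (hint a)
  have hA' : ∀ᵐ ω ∂P, ∀ T, 1 ≤ T →
      IsEstimate φ N R (fun t => attackedState c x₀ w ξ t ω) T (A T ω) := by
    rw [ae_all_iff]
    intro T
    by_cases hT : 1 ≤ T
    · filter_upwards [hA T hT] with ω hω _ using hω
    · exact .of_forall fun ω h => absurd h hT
  filter_upwards [hslln, hA', ae_all_iff.2 hwB] with ω hlim hest hbd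
  -- The bound may depend on `ω` through the possibly unbounded `x₀`, since the argument is
  -- pathwise. The factor 2 in `δ` counts two blocks per unit of `m`.
  refine not_tendsto_zero_of_gain hφ.convex (x := fun t => attackedState c x₀ w ξ t ω)
    (M := max ‖x₀ ω‖ (B + c)) (fun t => ?_) hest hafeas
    (δ := 2 * ∫ ω, blockGain φ c a (fun i : Fin 3 => w i ω, fun i => ξ 1 i ω) ∂P) (by positivity) ?_
  · cases t with
    | zero => exact le_max_left _ _
    | succ t => exact (norm_attackedState_succ_le hc.le x₀ ξ (hbd t)).trans (le_max_right _ _)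
  · set D : ℕ → ℝ := fun t => φ (attackedState c x₀ w ξ (t + 1) ω)
      - φ (attackedState c x₀ w ξ (t + 1) ω - a • attackedState c x₀ w ξ t ω) with hD
    have hpair : ∀ k, D (2 * k + 1) + D (2 * k + 2) = blockGain φ c a
        (fun i : Fin 3 => w (2 * k + i) ω, fun i => ξ (2 * k + 1) i ω) := by
      intro k
      simp only [hD, blockGain]
      rw [show 2 * k + 1 + 1 = 2 * k + 2 by ring, show 2 * k + 2 + 1 = 2 * (k + 1) + 1 by ring,
        attackedState_even, attackedState_odd, attackedState_odd]
      rfl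
    -- Step 0 alone involves `x₀` outside the blocks; its contribution `D 0` vanishes after division
    -- by `m`.
    have hsum : ∀ k, ∑ t ∈ Finset.range (2 * k + 1), D t = D 0 + ∑ j ∈ Finset.range k,
        blockGain φ c a (fun i : Fin 3 => w (2 * j + i) ω, fun i => ξ (2 * j + 1) i ω) := by
      intro k
      induction k with
      | zero => simp
      | succ k ih =>
        rw [show 2 * (k + 1) + 1 = 2 * k + 1 + 1 + 1 by ring, Finset.sum_range_succ,
          Finset.sum_range_succ, ih, Finset.sum_range_succ, ← hpair]
        ring
    have h := (tendsto_const_div_atTop_nhds_zero_nat (D 0)).add hlim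
    rw [zero_add] at h
    refine h.congr fun m => ?_
    rw [← add_div, show 4 * m + 1 = 2 * (2 * m) + 1 by ring]
    exact congrArg (· / (m : ℝ)) (hsum (2 * m)).symm
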